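/- **Definitions.** Let $\square_S$ be the symmetric cubical category, i.e. the free symmetric (strict) monoidal category on a co-cubical object (an object $1$ with maps $\varepsilon^-,\varepsilon^+:0\to1$ and $\eta:1\to0$ such that $\eta\varepsilon^-=\eta\varepsilon^+=\mathrm{id}_0$). Its objects are the natural numbers, and a morphism $m\to n$ assigns to each of $n$ output coordinates either a constant $-$ or $+$ or one of $m$ input coordinates, no input being used twice. A *symmetric cubical set* is a presheaf $C$ on $\square_S$; elements of $C(n)$ are its $n$-cells. The $0$-source (resp. $0$-target) of an $n$-cell is its face along the all-$-$ (resp. all-$+$) map $0\to n$. For a pointed set $(L,*)$, $!L$ is the symmetric cubical set whose $n$-cells are the lists of length $n$ of elements of $L$; faces delete an entry, degeneracies insert $*$, symmetries permute. A *higher dimensional automaton* (HDA) is a symmetric cubical set $C$ with a pointed set $L$ of labels, a morphism $\ell:C\to{!L}$ and an initial $0$-cell $i$. A morphism $(\kappa,\lambda)$ consists of a morphism $\kappa$ of symmetric cubical sets that preserves the initial cell and a pointed map $\lambda$ with $\ell'\kappa=(!\lambda)\ell$. This defines the category $\mathbf{HDA}$. An HDA is *reachable* if each of its $0$-cells can be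 reached from $i$ by a finite directed path of $1$-cells; $\mathbf{HDA}_r$ is the full subcategory of reachable HDA. A *Petri net* $N=(P,M_0,E,\mathrm{pre},\mathrm{post})$ consists of sets $P$ (places) and $E$ (events), $M_0\in\mathbb N^P$ and functions $\mathrm{pre},\mathrm{post}:E\to\mathbb N^P$. Put $\mathrm{pre}(*)=\mathrm{post}(*)=0$. A morphism $N\to N'$ is a function $\varphi:P'\to P$ with a partial function $\psi:E\to E'$ (value $*$ where undefined) such that $M_0'=M_0\circ\varphi$, $\mathrm{pre}'(\psi(e))=\mathrm{pre}(e)\circ\varphi$ and $\mathrm{post}'(\psi(e))=\mathrm{post}(e)\circ\varphi$ for all $e\in E$. This defines the category $\mathbf{PNet}$. Extend $\mathrm{pre}$ and $\mathrm{post}$ additively to *generalized events*, i.e. lists $l$ of elements of $E\uplus\{*\}$. There is a transition $M_1\xrightarrow{l}M_2$ between markings (elements of $\mathbb N^P$) if $M_1=M+\mathrm{pre}(l)$ and $M_2=M+\mathrm{post}(l)$ for some $M\in\mathbb N^P$; then $l$ is *enabled* at $M_1$ and $M_1/l:=M_2$. A marking is *reachable* if it is obtained from $M_0$ by finitely many transitions.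 *The functor* $\mathrm{hda}:\mathbf{PNet}\to\mathbf{HDA}$. The $n$-cells of $\mathrm{hda}(N)$ are the pairs $(M,l)$ of a reachable marking $M$ and a generalized event $l$ of length $n$ enabled at $M$; $\partial_i^-(M,l)=(M,\partial_i l)$, $\partial_i^+(M,l)=(M/e_i,\partial_i l)$ with $e_i$ the $i$-th entry of $l$; degeneracies and symmetries act on $l$ as in $!(E\uplus\{*\})$; the label of $(M,l)$ is $l$, and the initial state is $M_0$. A morphism $(\varphi,\psi)$ is sent to $(M,l)\mapsto(M\circ\varphi,!\psi(l))$. Let $\mathrm{hda}_{\mathrm{all}}:\mathbf{PNet}\to\mathbf{HDA}$ be defined in the same way with all markings in place of the reachable ones. *The functor* $\mathrm{pn}:\mathbf{HDA}\to\mathbf{PNet}$. A *region* of an HDA $C$ is a pair $(R,S)$, where $R=(R',R'')$ maps lists of labels to $\mathbb N\times\mathbb N$, is additive for concatenation and is $(0,0)$ on the empty list, and $S:C(0)\to\mathbb N$ is such that for each cell $y$ of any dimension with $0$-source $x$ and $0$-target $x'$ there is $k\in\mathbb N$ with $S(x)=k+R'(\ell(y))$ and $S(x')=k+R''(\ell(y))$.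 The places of $\mathrm{pn}(C)$ are the regions of $C$, its events are the labels different from $*$, $\mathrm{pre}(e)(R,S)=R'(e)$, $\mathrm{post}(e)(R,S)=R''(e)$ and $M_0(R,S)=S(i)$. A morphism $(\kappa,\lambda)$ is sent to inverse image of regions, $(R,S)\mapsto(R\circ{!\lambda},S\circ\kappa_0)$, together with $\lambda$ seen as a partial function. **Theorem.** 1. For every Petri net $N$ the HDA $\mathrm{hda}(N)$ is reachable, and the functor $\mathrm{hda}:\mathbf{PNet}\to\mathbf{HDA}_r$ is right adjoint to the restriction of $\mathrm{pn}$ to $\mathbf{HDA}_r$. 2. The functor $\mathrm{hda}_{\mathrm{all}}:\mathbf{PNet}\to\mathbf{HDA}$ is right adjoint to $\mathrm{pn}:\mathbf{HDA}\to\mathbf{PNet}$. -/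

import Mathlib

open CategoryTheory Opposite

universe u

/-! ## The symmetric cubical category -/

/-- Objects of the symmetric cubical category: the natural numbers. -/
structure BoxS where
  dim : ℕ

namespace BoxS

/-- A morphism `m ⟶ n` of the symmetric cubical category, i.e. of the free symmetric strict monoidal
category on a co-cubical object (an object `1` with `ε⁻, ε⁺ : 0 ⟶ 1` and `η : 1 ⟶ 0` such that
`η ∘ ε⁻ = id = η ∘ ε⁺`), given by its normal form. Geometrically it is a map of elementary cubes
`{0,1}^m → {0,1}^n`: each of the `n` output coordinates is either a constant (`inl false` for `-`,
`inl true` for `+`) or one of the `m` input coordinates, no input coordinate being used twice. -/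
@[ext]
structure Hom (m n : BoxS) : Type where
  toFun : Fin n.dim → Bool ⊕ Fin m.dim
  inj : ∀ i i' j, toFun i = Sum.inr j → toFun i' = Sum.inr j → i = i'

/-- Composition is substitution of coordinates. -/
instance : Category BoxS where
  Hom := Hom
  id n := ⟨Sum.inr, fun i i' j h h' => Sum.inr_injective (h.trans h'.symm)⟩
  comp f g :=
    ⟨fun k => Sum.elim Sum.inl f.toFun (g.toFun k), by
      intro k k' j h h'
      cases hk : g.toFun k with
      | inl b => simp [hk] at h
      | inr i =>
        cases hk' : g.toFun k' with
        | inl b => simp [hk'] at h'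
        | inr i' =>
          simp only [hk, hk', Sum.elim_inr] at h h'
          have := f.inj i i' j h h'
          subst this
          exact g.inj k k' i hk hk'⟩
  id_comp f := by
    apply Hom.ext; funext k
    cases h : f.toFun k <;> simp [h]
  comp_id f := by
    apply Hom.ext; funext k; simp
  assoc f g h := by
    apply Hom.ext; funext k
    cases hk : h.toFun k <;> simp [hk]

theorem id_toFun (n : BoxS) : Hom.toFun (𝟙 n) = Sum.inr := rfl

theorem comp_toFun {m n p : BoxS} (f : m ⟶ n) (g : n ⟶ p) (k : Fin p.dim) :
    Hom.toFun (f ≫ g) k = Sum.elim Sum.inl (Hom.toFun f) (Hom.toFun g k) := rfl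

/-- The generator `ε_i^α : n ⟶ n + 1`, which inserts the constant `α` as `i`-th coordinate. -/
def face (α : Bool) {n : ℕ} (i : Fin (n + 1)) : (⟨n⟩ : BoxS) ⟶ ⟨n + 1⟩ :=
  Hom.mk (m := ⟨n⟩) (n := ⟨n + 1⟩)
    (i.insertNth (α := fun _ => Bool ⊕ Fin n) (Sum.inl α) Sum.inr) (by
      intro k k' j h h'
      induction k using Fin.succAboveCases i with
      | x => simp at h
      | p k =>
        induction k' using Fin.succAboveCases i with
        | x => simp at h'
        | p k' =>
          simp only [Fin.insertNth_apply_succAbove, Sum.inr.injEq] at h h'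
          rw [h, h'])

/-- The morphism `0 ⟶ n` all of whose coordinates are the constant `α`. -/
def corner (α : Bool) (n : ℕ) : (⟨0⟩ : BoxS) ⟶ ⟨n⟩ :=
  Hom.mk (m := ⟨0⟩) (n := ⟨n⟩) (fun _ => Sum.inl α) (by intro i i' j; exact j.elim0)

/-- `corner α n` is the iterated `0`-th face `ε_0^α ⋯ ε_0^α`. -/
theorem corner_zero (α : Bool) : corner α 0 = 𝟙 _ := by
  apply Hom.ext; funext k; exact k.elim0

theorem corner_succ (α : Bool) (n : ℕ) : corner α (n + 1) = corner α n ≫ face α 0 := by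
  apply Hom.ext; funext k
  rw [comp_toFun]
  induction k using Fin.cases with
  | zero => simp [corner, face]
  | succ k => simp [corner, face]

end BoxS

/-- The category of symmetric cubical sets. -/
abbrev SCSet := BoxSᵒᵖ ⥤ Type u

/-! ## The labeling cubical set -/

open Classical in
/-- The action of a morphism `f : m ⟶ n` of the symmetric cubical category on lists of length `n`
of elements of a pointed set: the labels of the coordinates which `f` makes constant are removed,
the others are permuted as prescribed by `f`, and the distinguished element is inserted at the input
coordinates that `f` does not use. -/
noncomputable def pushLabel {X : Type u} (pt : X) {m n : BoxS} (f : m ⟶ n) (l : Fin n.dim → X) :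
    Fin m.dim → X :=
  fun j => if h : ∃ i, BoxS.Hom.toFun f i = Sum.inr j then l h.choose else pt

theorem pushLabel_of_eq {X : Type u} (pt : X) {m n : BoxS} (f : m ⟶ n) (l : Fin n.dim → X)
    {i : Fin n.dim} {j : Fin m.dim} (h : BoxS.Hom.toFun f i = Sum.inr j) :
    pushLabel pt f l j = l i := by
  have h' : ∃ i, BoxS.Hom.toFun f i = Sum.inr j := ⟨i, h⟩
  rw [pushLabel, dif_pos h', BoxS.Hom.inj f _ _ j h'.choose_spec h]

theorem pushLabel_of_ne {X : Type u} (pt : X) {m n : BoxS} (f : m ⟶ n) (l : Fin n.dim → X)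
    {j : Fin m.dim} (h : ∀ i, BoxS.Hom.toFun f i ≠ Sum.inr j) :
    pushLabel pt f l j = pt := by
  rw [pushLabel, dif_neg (by push Not; exact h)]

theorem pushLabel_id {X : Type u} (pt : X) (n : BoxS) (l : Fin n.dim → X) :
    pushLabel pt (𝟙 n) l = l := by
  funext j
  exact pushLabel_of_eq pt (𝟙 n) l rfl

theorem pushLabel_comp {X : Type u} (pt : X) {m n p : BoxS} (f : m ⟶ n) (g : n ⟶ p)
    (l : Fin p.dim → X) :
    pushLabel pt (f ≫ g) l = pushLabel pt f (pushLabel pt g l) := by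
  funext j
  by_cases h : ∃ i, BoxS.Hom.toFun f i = Sum.inr j
  · obtain ⟨i, hi⟩ := h
    rw [pushLabel_of_eq pt f _ hi]
    by_cases h' : ∃ k, BoxS.Hom.toFun g k = Sum.inr i
    · obtain ⟨k, hk⟩ := h'
      rw [pushLabel_of_eq pt g _ hk]
      exact pushLabel_of_eq pt _ _ (by rw [BoxS.comp_toFun, hk]; exact hi)
    · push Not at h'
      rw [pushLabel_of_ne pt g _ h']
      refine pushLabel_of_ne pt _ _ fun k hk => ?_
      rw [BoxS.comp_toFun] at hk
      cases hg : BoxS.Hom.toFun g k with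
      | inl b => simp [hg] at hk
      | inr i' =>
        rw [hg] at hk
        exact h' k (hg.trans (by rw [BoxS.Hom.inj f i' i j hk hi]))
  · push Not at h
    rw [pushLabel_of_ne pt f _ h]
    refine pushLabel_of_ne pt _ _ fun k hk => ?_
    rw [BoxS.comp_toFun] at hk
    cases hg : BoxS.Hom.toFun g k with
    | inl b => simp [hg] at hk
    | inr i' =>
      rw [hg] at hk
      exact h i' hk

theorem pushLabel_map {X Y : Type u} (pt : X) (pt' : Y) (t : X → Y) (ht : t pt = pt')
    {m n : BoxS} (f : m ⟶ n) (l : Fin n.dim → X) :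
    pushLabel pt' f (t ∘ l) = t ∘ pushLabel pt f l := by
  funext j
  by_cases h : ∃ i, BoxS.Hom.toFun f i = Sum.inr j
  · obtain ⟨i, hi⟩ := h
    rw [pushLabel_of_eq pt' f _ hi, Function.comp_apply, Function.comp_apply,
      pushLabel_of_eq pt f _ hi]
  · push Not at h
    rw [pushLabel_of_ne pt' f _ h, Function.comp_apply, pushLabel_of_ne pt f _ h, ht]

/-- The labeling cubical set `!L` of a pointed set `L`, as a functor of `L`: its `n`-cells are the
lists of length `n` of elements of `L`. -/
noncomputable def lcs : Pointed.{u} ⥤ SCSet.{u} where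
  obj L :=
    { obj := fun n => Fin n.unop.dim → L.X
      map := fun f => TypeCat.ofHom (pushLabel L.point f.unop)
      map_id := fun n => by
        refine ConcreteCategory.hom_ext _ _ fun l => ?_
        exact pushLabel_id L.point n.unop l
      map_comp := fun f g => by
        refine ConcreteCategory.hom_ext _ _ fun l => ?_
        exact pushLabel_comp L.point g.unop f.unop l }
  map {L L'} t :=
    { app := fun n => TypeCat.ofHom fun l => Pointed.Hom.toFun t ∘ l
      naturality := fun m n f => by
        refine ConcreteCategory.hom_ext _ _ fun l => ?_
        exact (pushLabel_map L.point L'.point (Pointed.Hom.toFun t) (Pointed.Hom.map_point t)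
          f.unop l).symm }
  map_id L := rfl
  map_comp s t := rfl

/-! ## Higher dimensional automata -/

/-- A higher dimensional automaton: a symmetric cubical set labeled by a pointed set of labels,
together with an initial state. -/
structure HDA : Type (u + 1) where
  cells : SCSet.{u}
  labels : Pointed.{u}
  label : cells ⟶ lcs.obj labels
  init : cells.obj (op ⟨0⟩)

namespace HDA

/-- The type of `n`-cells. -/
abbrev Cell (C : HDA.{u}) (n : ℕ) : Type u := C.cells.obj (op ⟨n⟩)

/-- The label of an `n`-cell: a list of `n` labels. -/
def lab (C : HDA.{u}) {n : ℕ} (y : C.Cell n) : Fin n → C.labels.X := C.label.app (op ⟨n⟩) y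

/-- The 0-source (`α = false`) and the 0-target (`α = true`) of a cell. -/
def vertex (C : HDA.{u}) (α : Bool) {n : ℕ} (y : C.Cell n) : C.Cell 0 :=
  C.cells.map (BoxS.corner α n).op y

/-- A morphism of HDA. -/
@[ext]
structure Hom (C D : HDA.{u}) : Type u where
  /-- the map on cells -/
  map : C.cells ⟶ D.cells
  /-- the pointed function on labels -/
  lam : C.labels ⟶ D.labels
  comm : map ≫ D.label = C.label ≫ lcs.map lam
  init : map.app (op ⟨0⟩) C.init = D.init

instance : Category HDA.{u} where
  Hom := Hom
  id C := ⟨𝟙 _, 𝟙 _, by simp, rfl⟩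
  comp {C D E} f g := ⟨f.map ≫ g.map, f.lam ≫ g.lam, by
      rw [Category.assoc, g.comm, ← Category.assoc, f.comm, Category.assoc, ← Functor.map_comp],
    by
      have h1 := f.init
      have h2 := g.init
      rw [← h1] at h2
      exact h2⟩
  id_comp f := by apply Hom.ext <;> simp
  comp_id f := by apply Hom.ext <;> simp
  assoc f g h := by apply Hom.ext <;> simp

theorem Hom.lab_map {C D : HDA.{u}} (f : C ⟶ D) {n : ℕ} (y : C.Cell n) :
    D.lab ((Hom.map f).app (op ⟨n⟩) y) = (Hom.lam f).toFun ∘ C.lab y :=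
  congrArg (fun t : C.cells ⟶ lcs.obj D.labels => t.app (op ⟨n⟩) y) (Hom.comm f)

theorem Hom.vertex_map {C D : HDA.{u}} (f : C ⟶ D) (α : Bool) {n : ℕ} (y : C.Cell n) :
    D.vertex α ((Hom.map f).app (op ⟨n⟩) y) = (Hom.map f).app (op ⟨0⟩) (C.vertex α y) :=
  (NatTrans.naturality_apply (Hom.map f) (BoxS.corner α n).op y).symm

/-- There is a 1-cell from `x` to `x'`. -/
def Edge (C : HDA.{u}) (x x' : C.Cell 0) : Prop :=
  ∃ y : C.Cell 1, C.vertex false y = x ∧ C.vertex true y = x'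

/-- An HDA all of whose 0-cells can be reached from the initial state by a finite directed path of
1-cells. -/
def IsReachable : ObjectProperty HDA.{u} := fun C =>
  ∀ x : C.Cell 0, Relation.ReflTransGen C.Edge C.init x

end HDA

/-! ## Petri nets -/

/-- A Petri net: `P` are the places and `E` the events. -/
structure PNet : Type (u + 1) where
  P : Type u
  E : Type u
  init : P → ℕ
  pre : E → P → ℕ
  post : E → P → ℕ

namespace PNet

/-- Markings. -/
abbrev Marking (N : PNet.{u}) : Type u := N.P → ℕ

/-- The precondition of an element of `E ⊎ {*}`, with that of `*` (which is `none`) being `0`. -/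
def preO (N : PNet.{u}) (e : Option N.E) : N.Marking := e.elim 0 N.pre

/-- The postcondition of an element of `E ⊎ {*}`, with that of `*` being `0`. -/
def postO (N : PNet.{u}) (e : Option N.E) : N.Marking := e.elim 0 N.post

/-- The precondition of a generalized event, i.e. of a list of elements of `E ⊎ {*}`. -/
def preL (N : PNet.{u}) {n : ℕ} (l : Fin n → Option N.E) : N.Marking := ∑ i, N.preO (l i)

/-- The postcondition of a generalized event. -/
def postL (N : PNet.{u}) {n : ℕ} (l : Fin n → Option N.E) : N.Marking := ∑ i, N.postO (l i)

/-- The transition relation `M₁ -l-> M₂` for a generalized event `l`. -/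
def Step (N : PNet.{u}) (M₁ : N.Marking) {n : ℕ} (l : Fin n → Option N.E) (M₂ : N.Marking) : Prop :=
  ∃ M : N.Marking, M₁ = M + N.preL l ∧ M₂ = M + N.postL l

/-- The generalized event `l` is enabled at `M`. -/
def Enabled (N : PNet.{u}) (M : N.Marking) {n : ℕ} (l : Fin n → Option N.E) : Prop :=
  ∃ M', N.Step M l M'

/-- A marking is reachable if it is obtained from the initial marking by finitely many transitions
along generalized events. -/
def Reachable (N : PNet.{u}) (M : N.Marking) : Prop :=
  Relation.ReflTransGen (fun M₁ M₂ => ∃ (n : ℕ) (l : Fin n → Option N.E), N.Step M₁ l M₂) N.init M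

/-- A morphism of Petri nets: a function on places, going backwards, and a partial function on
events. Where the latter is undefined, the pre- and postcondition of its value are `0`. -/
@[ext]
structure Hom (N N' : PNet.{u}) : Type u where
  onPlace : N'.P → N.P
  onEvent : N.E → Option N'.E
  init : N'.init = N.init ∘ onPlace
  pre : ∀ e, N'.preO (onEvent e) = N.pre e ∘ onPlace
  post : ∀ e, N'.postO (onEvent e) = N.post e ∘ onPlace

theorem Hom.preO_bind {N N' : PNet.{u}} (f : Hom N N') (e : Option N.E) :
    N'.preO (e.bind f.onEvent) = N.preO e ∘ f.onPlace := by
  cases e with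
  | none => rfl
  | some e => exact f.pre e

theorem Hom.postO_bind {N N' : PNet.{u}} (f : Hom N N') (e : Option N.E) :
    N'.postO (e.bind f.onEvent) = N.postO e ∘ f.onPlace := by
  cases e with
  | none => rfl
  | some e => exact f.post e

instance : Category PNet.{u} where
  Hom := Hom
  id N := ⟨id, some, rfl, fun _ => rfl, fun _ => rfl⟩
  comp f g :=
    { onPlace := f.onPlace ∘ g.onPlace
      onEvent := fun e => (f.onEvent e).bind g.onEvent
      init := by rw [g.init, f.init]; rfl
      pre := fun e => by rw [g.preO_bind, f.pre]; rfl
      post := fun e => by rw [g.postO_bind, f.post]; rfl }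
  id_comp f := rfl
  comp_id f := by apply Hom.ext <;> simp
  assoc f g h := by apply Hom.ext <;> simp [Function.comp_assoc, Option.bind_assoc]

/-! ### Firing -/

/-- The marking `M/l` (meaningful when `l` is enabled at `M`). -/
def fire (N : PNet.{u}) (M : N.Marking) {n : ℕ} (l : Fin n → Option N.E) : N.Marking :=
  M - N.preL l + N.postL l

theorem enabled_iff (N : PNet.{u}) (M : N.Marking) {n : ℕ} (l : Fin n → Option N.E) :
    N.Enabled M l ↔ N.preL l ≤ M := by
  constructor
  · rintro ⟨M', K, rfl, -⟩ p
    simp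
  · intro h
    refine ⟨N.fire M l, M - N.preL l, ?_, rfl⟩
    funext p
    exact (Nat.sub_add_cancel (h p)).symm

theorem step_iff (N : PNet.{u}) (M M' : N.Marking) {n : ℕ} (l : Fin n → Option N.E) :
    N.Step M l M' ↔ N.Enabled M l ∧ M' = N.fire M l := by
  constructor
  · rintro ⟨K, rfl, rfl⟩
    refine ⟨⟨_, K, rfl, rfl⟩, ?_⟩
    funext p
    simp [fire]
  · rintro ⟨h, rfl⟩
    obtain ⟨M', K, rfl, h⟩ := h
    refine ⟨K, rfl, ?_⟩
    funext p
    simp [fire]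

/-- The sublist of the labels of those coordinates on which a morphism of the symmetric cubical
category is the constant `+`; the other labels are replaced by `*`. -/
def plusPart (N : PNet.{u}) {m n : BoxS} (f : m ⟶ n) (l : Fin n.dim → Option N.E) :
    Fin n.dim → Option N.E :=
  fun i => if BoxS.Hom.toFun f i = Sum.inl true then l i else none

end PNet

theorem sum_pushLabel {X : Type u} (pt : X) (h : X → ℕ) (h0 : h pt = 0) {m n : BoxS} (f : m ⟶ n)
    (l : Fin n.dim → X) (c : Fin m.dim → ℕ) :
    ∑ j, c j * h (pushLabel pt f l j) =
      ∑ i, Sum.elim (fun _ => 0) c (BoxS.Hom.toFun f i) * h (l i) := by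
  have key : ∀ j, h (pushLabel pt f l j) =
      ∑ i, if BoxS.Hom.toFun f i = Sum.inr j then h (l i) else 0 := by
    intro j
    by_cases hj : ∃ i, BoxS.Hom.toFun f i = Sum.inr j
    · obtain ⟨i, hi⟩ := hj
      rw [pushLabel_of_eq pt f l hi, Finset.sum_eq_single i]
      · rw [if_pos hi]
      · intro i' _ hne
        rw [if_neg]
        exact fun hi' => hne (BoxS.Hom.inj f _ _ _ hi' hi)
      · simp
    · push Not at hj
      rw [pushLabel_of_ne pt f l hj, h0]
      simp [hj]
  simp_rw [key, Finset.mul_sum]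
  rw [Finset.sum_comm]
  refine Finset.sum_congr rfl fun i _ => ?_
  cases hf : BoxS.Hom.toFun f i with
  | inl b => simp
  | inr j => simp [Sum.inr.injEq]

namespace PNet

theorem preL_apply (N : PNet.{u}) {n : ℕ} (l : Fin n → Option N.E) (p : N.P) :
    N.preL l p = ∑ i, N.preO (l i) p := by
  simp [preL]

theorem postL_apply (N : PNet.{u}) {n : ℕ} (l : Fin n → Option N.E) (p : N.P) :
    N.postL l p = ∑ i, N.postO (l i) p := by
  simp [postL]

theorem Hom.preL_map {N N' : PNet.{u}} (f : N ⟶ N') {n : ℕ} (l : Fin n → Option N.E) :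
    N'.preL (fun i => (l i).bind (Hom.onEvent f)) = N.preL l ∘ Hom.onPlace f := by
  funext p
  simp only [Function.comp, preL_apply]
  refine Finset.sum_congr rfl fun i _ => ?_
  rw [Hom.preO_bind f]
  rfl

theorem Hom.postL_map {N N' : PNet.{u}} (f : N ⟶ N') {n : ℕ} (l : Fin n → Option N.E) :
    N'.postL (fun i => (l i).bind (Hom.onEvent f)) = N.postL l ∘ Hom.onPlace f := by
  funext p
  simp only [Function.comp, postL_apply]
  refine Finset.sum_congr rfl fun i _ => ?_
  rw [Hom.postO_bind f]
  rfl

theorem Hom.fire_map {N N' : PNet.{u}} (f : N ⟶ N') (M : N.Marking) {n : ℕ}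
    (l : Fin n → Option N.E) :
    N'.fire (M ∘ Hom.onPlace f) (fun i => (l i).bind (Hom.onEvent f)) =
      N.fire M l ∘ Hom.onPlace f := by
  rw [fire, Hom.preL_map f, Hom.postL_map f]
  rfl

theorem Hom.step_map {N N' : PNet.{u}} (f : N ⟶ N') {M M' : N.Marking} {n : ℕ}
    {l : Fin n → Option N.E} (h : N.Step M l M') :
    N'.Step (M ∘ Hom.onPlace f) (fun i => (l i).bind (Hom.onEvent f)) (M' ∘ Hom.onPlace f) := by
  obtain ⟨K, rfl, rfl⟩ := h
  exact ⟨K ∘ Hom.onPlace f, by rw [Hom.preL_map f]; rfl, by rw [Hom.postL_map f]; rfl⟩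

theorem Hom.reachable_map {N N' : PNet.{u}} (f : N ⟶ N') {M : N.Marking} (h : N.Reachable M) :
    N'.Reachable (M ∘ Hom.onPlace f) := by
  induction h with
  | refl =>
    have h : N'.init = N.init ∘ Hom.onPlace f := Hom.init f
    rw [← h]
    exact Relation.ReflTransGen.refl
  | tail _ h ih =>
    obtain ⟨n, l, h⟩ := h
    exact ih.tail ⟨n, _, Hom.step_map f h⟩

theorem sum_plusPart (N : PNet.{u}) (h : Option N.E → ℕ) (h0 : h none = 0) {m n : BoxS} (f : m ⟶ n)
    (l : Fin n.dim → Option N.E) :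
    ∑ i, h (N.plusPart f l i) =
      ∑ i, (if BoxS.Hom.toFun f i = Sum.inl true then 1 else 0) * h (l i) := by
  refine Finset.sum_congr rfl fun i _ => ?_
  unfold plusPart
  split_ifs <;> simp [h0]

theorem sum_push_add_plus (N : PNet.{u}) (h : Option N.E → ℕ) (h0 : h none = 0) {m n : BoxS}
    (f : m ⟶ n) (l : Fin n.dim → Option N.E) :
    (∑ j, h (pushLabel none f l j)) + ∑ i, h (N.plusPart f l i) ≤ ∑ i, h (l i) := by
  have h1 := sum_pushLabel none h h0 f l (fun _ => 1)
  simp only [one_mul] at h1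
  rw [h1, sum_plusPart N h h0, ← Finset.sum_add_distrib]
  refine Finset.sum_le_sum fun i _ => ?_
  cases hf : BoxS.Hom.toFun f i with
  | inl b => cases b <;> simp
  | inr j => simp

theorem sum_plus_comp (N : PNet.{u}) (h : Option N.E → ℕ) (h0 : h none = 0) {m n p : BoxS}
    (f : m ⟶ n) (g : n ⟶ p) (l : Fin p.dim → Option N.E) :
    ∑ k, h (N.plusPart (f ≫ g) l k) =
      (∑ k, h (N.plusPart g l k)) + ∑ i, h (N.plusPart f (pushLabel none g l) i) := by
  rw [sum_plusPart N h h0, sum_plusPart N h h0, sum_plusPart N h h0,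
    sum_pushLabel none h h0, ← Finset.sum_add_distrib]
  refine Finset.sum_congr rfl fun k _ => ?_
  rw [BoxS.comp_toFun]
  cases hg : BoxS.Hom.toFun g k with
  | inl b => simp
  | inr i => by_cases hf : BoxS.Hom.toFun f i = Sum.inl true <;> simp [hf]

theorem plusPart_enabled (N : PNet.{u}) {M : N.Marking} {m n : BoxS} (f : m ⟶ n)
    {l : Fin n.dim → Option N.E} (h : N.Enabled M l) : N.Enabled M (N.plusPart f l) := by
  rw [enabled_iff] at h ⊢
  intro p
  have h1 := h p
  have h2 := N.sum_push_add_plus (fun e => N.preO e p) rfl f l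
  rw [preL_apply] at h1 ⊢
  exact le_trans (le_trans (Nat.le_add_left _ _) h2) h1

theorem pushLabel_enabled (N : PNet.{u}) {M : N.Marking} {m n : BoxS} (f : m ⟶ n)
    {l : Fin n.dim → Option N.E} (h : N.Enabled M l) :
    N.Enabled (N.fire M (N.plusPart f l)) (pushLabel none f l) := by
  rw [enabled_iff] at h ⊢
  intro p
  have h1 := h p
  have h2 := N.sum_push_add_plus (fun e => N.preO e p) rfl f l
  simp only [fire, Pi.add_apply, Pi.sub_apply, preL_apply, postL_apply] at h1 ⊢
  omega

theorem fire_id (N : PNet.{u}) (M : N.Marking) {n : BoxS} (l : Fin n.dim → Option N.E) :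
    N.fire M (N.plusPart (𝟙 n) l) = M := by
  funext p
  simp [fire, preL_apply, postL_apply, plusPart, BoxS.id_toFun, preO, postO]

theorem fire_comp (N : PNet.{u}) {M : N.Marking} {m n p : BoxS} (f : m ⟶ n) (g : n ⟶ p)
    {l : Fin p.dim → Option N.E} (h : N.Enabled M l) :
    N.fire M (N.plusPart (f ≫ g) l) =
      N.fire (N.fire M (N.plusPart g l)) (N.plusPart f (pushLabel none g l)) := by
  have h' := (N.enabled_iff _ _).1 (N.plusPart_enabled (f ≫ g) h)
  funext q
  have h1 := h' q
  have h2 := N.sum_plus_comp (fun e => N.preO e q) rfl f g l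
  have h3 := N.sum_plus_comp (fun e => N.postO e q) rfl f g l
  simp only [fire, Pi.add_apply, Pi.sub_apply, preL_apply, postL_apply] at h1 ⊢
  omega

theorem plusPart_map {N N' : PNet.{u}} (t : Option N.E → Option N'.E) (ht : t none = none)
    {m n : BoxS} (f : m ⟶ n) (l : Fin n.dim → Option N.E) :
    N'.plusPart f (t ∘ l) = t ∘ N.plusPart f l := by
  funext i
  simp only [plusPart, Function.comp]
  split_ifs
  · rfl
  · exact ht.symm

/-! ### From Petri nets to HDA -/

/-- A set of markings which contains the initial marking and is closed under transitions. -/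
structure StateSet (N : PNet.{u}) : Type u where
  carrier : Set N.Marking
  init_mem : N.init ∈ carrier
  step_mem : ∀ (M M' : N.Marking) (n : ℕ) (l : Fin n → Option N.E),
    M ∈ carrier → N.Step M l M' → M' ∈ carrier

/-- The set of reachable markings. -/
def reachableMarkings (N : PNet.{u}) : N.StateSet where
  carrier := {M | N.Reachable M}
  init_mem := Relation.ReflTransGen.refl
  step_mem _ _ n l h h' := Relation.ReflTransGen.tail h ⟨n, l, h'⟩

/-- The set of all markings. -/
def allMarkings (N : PNet.{u}) : N.StateSet where
  carrier := Set.univ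
  init_mem := trivial
  step_mem _ _ _ _ _ _ := trivial

/-- The `n`-cells of the HDA of a net with set of states `S`: the pairs of a marking `M ∈ S` and a
generalized event `l` of length `n` enabled at `M`. -/
@[ext]
structure EvCell (N : PNet.{u}) (S : N.StateSet) (n : ℕ) : Type u where
  marking : N.Marking
  event : Fin n → Option N.E
  mem : marking ∈ S.carrier
  enabled : N.Enabled marking event

/-- The action of a morphism of the symmetric cubical category: the events at the coordinates which
are made constant equal to `+` are fired, and the other ones are acted upon as in `!(E ⊎ {*})`. In
particular `∂_i^-(M, l) = (M, ∂_i^- l)` and `∂_i^+(M, l) = (M/e_i, ∂_i^+ l)`, where `e_i` is the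
`i`-th element of `l`. -/
noncomputable def EvCell.act {N : PNet.{u}} {S : N.StateSet} {m n : BoxS} (f : m ⟶ n)
    (c : N.EvCell S n.dim) : N.EvCell S m.dim where
  marking := N.fire c.marking (N.plusPart f c.event)
  event := pushLabel none f c.event
  mem := S.step_mem _ _ _ _ c.mem ((N.step_iff _ _ _).2 ⟨N.plusPart_enabled f c.enabled, rfl⟩)
  enabled := N.pushLabel_enabled f c.enabled

/-- The HDA of a net, with a given set of states: its labels are `E ⊎ {*}`, the label of `(M, l)` is
`l`, and its initial state is the initial marking. -/
noncomputable def hdaOn (N : PNet.{u}) (S : N.StateSet) : HDA.{u} where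
  cells :=
    { obj := fun n => N.EvCell S n.unop.dim
      map := fun f => TypeCat.ofHom (EvCell.act f.unop)
      map_id := fun n => by
        refine ConcreteCategory.hom_ext _ _ fun c => ?_
        exact EvCell.ext (N.fire_id _ _) (pushLabel_id _ _ _)
      map_comp := fun f g => by
        refine ConcreteCategory.hom_ext _ _ fun c => ?_
        exact EvCell.ext (N.fire_comp _ _ c.enabled) (pushLabel_comp _ _ _ _) }
  labels := ⟨Option N.E, none⟩
  label :=
    { app := fun n => TypeCat.ofHom fun c => c.event
      naturality := fun m n f => rfl }
  init := ⟨N.init, Fin.elim0, S.init_mem, (N.enabled_iff _ _).2 (by simp [preL])⟩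

/-- The morphism of HDA induced by a morphism of nets `(φ, ψ)`: it sends `(M, l)` to
`(M ∘ φ, !ψ l)`. -/
noncomputable def hdaOnMap {N N' : PNet.{u}} (f : N ⟶ N') (S : N.StateSet) (S' : N'.StateSet)
    (h : ∀ M ∈ S.carrier, M ∘ Hom.onPlace f ∈ S'.carrier) : N.hdaOn S ⟶ N'.hdaOn S' :=
  HDA.Hom.mk (C := N.hdaOn S) (D := N'.hdaOn S')
    { app := fun n => TypeCat.ofHom fun c : N.EvCell S n.unop.dim =>
        (⟨c.marking ∘ Hom.onPlace f, fun i => (c.event i).bind (Hom.onEvent f), h _ c.mem, by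
          obtain ⟨M', hM⟩ := c.enabled
          exact ⟨_, Hom.step_map f hM⟩⟩ : N'.EvCell S' n.unop.dim)
      naturality := fun m n g => by
        refine ConcreteCategory.hom_ext _ _ fun c => ?_
        refine EvCell.ext ?_ ?_
        · refine ((Hom.fire_map f _ _).symm.trans ?_)
          exact congrArg (N'.fire _)
            (plusPart_map (fun e => e.bind (Hom.onEvent f)) rfl g.unop
              (EvCell.event c)).symm
        · exact (pushLabel_map none none (fun e => e.bind (Hom.onEvent f)) rfl g.unop
            (EvCell.event c)).symm }
    ⟨fun e : Option N.E => e.bind (Hom.onEvent f), rfl⟩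
    rfl
    (EvCell.ext (Hom.init f).symm (funext fun i => i.elim0))

end PNet

/-- The functor `hda : PNet ⥤ HDA`, whose value at `N` has the reachable markings as 0-cells. -/
noncomputable def hda : PNet.{u} ⥤ HDA.{u} where
  obj N := N.hdaOn N.reachableMarkings
  map f := PNet.hdaOnMap f _ _ fun _ => PNet.Hom.reachable_map f
  map_id N := by
    apply HDA.Hom.ext
    · refine NatTrans.ext (funext fun n => ConcreteCategory.hom_ext _ _ fun c => ?_)
      exact PNet.EvCell.ext rfl (funext fun i => Option.bind_fun_some _)
    · exact Pointed.Hom.ext (funext fun e => Option.bind_fun_some _)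
  map_comp f g := by
    apply HDA.Hom.ext
    · refine NatTrans.ext (funext fun n => ConcreteCategory.hom_ext _ _ fun c => ?_)
      exact PNet.EvCell.ext rfl (funext fun i => (Option.bind_assoc _ _ _).symm)
    · exact Pointed.Hom.ext (funext fun e => (Option.bind_assoc _ _ _).symm)

/-- The variant of `hda` in which all the markings are taken as 0-cells. -/
noncomputable def hdaAll : PNet.{u} ⥤ HDA.{u} where
  obj N := N.hdaOn N.allMarkings
  map f := PNet.hdaOnMap f _ _ fun _ _ => trivial
  map_id N := by
    apply HDA.Hom.ext
    · refine NatTrans.ext (funext fun n => ConcreteCategory.hom_ext _ _ fun c => ?_)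
      exact PNet.EvCell.ext rfl (funext fun i => Option.bind_fun_some _)
    · exact Pointed.Hom.ext (funext fun e => Option.bind_fun_some _)
  map_comp f g := by
    apply HDA.Hom.ext
    · refine NatTrans.ext (funext fun n => ConcreteCategory.hom_ext _ _ fun c => ?_)
      exact PNet.EvCell.ext rfl (funext fun i => (Option.bind_assoc _ _ _).symm)
    · exact Pointed.Hom.ext (funext fun e => (Option.bind_assoc _ _ _).symm)

/-! ## From HDA to Petri nets -/

/-- A pre-region of a set `L`: functions from the lists of elements of `L` of each length to
`ℕ × ℕ`, which are additive for concatenation. -/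
@[ext]
structure PreRegion (L : Type u) : Type u where
  R : ∀ n : ℕ, (Fin n → L) → ℕ × ℕ
  append : ∀ (m n : ℕ) (e : Fin m → L) (f : Fin n → L), R (m + n) (Fin.append e f) = R m e + R n f
  zero : ∀ e : Fin 0 → L, R 0 e = (0, 0)

/-- A region of an HDA. -/
@[ext]
structure HDA.Region (C : HDA.{u}) : Type u extends PreRegion C.labels.X where
  S : C.Cell 0 → ℕ
  cond : ∀ (n : ℕ) (y : C.Cell n), ∃ k : ℕ,
    S (C.vertex false y) = k + (R n (C.lab y)).1 ∧ S (C.vertex true y) = k + (R n (C.lab y)).2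

namespace HDA

/-- The value of a region on a single label. -/
def Region.val {C : HDA.{u}} (r : C.Region) (e : C.labels.X) : ℕ × ℕ := r.R 1 (fun _ => e)

theorem Region.R_const {C : HDA.{u}} (r : C.Region) (e : C.labels.X) (n : ℕ) :
    r.R n (fun _ => e) = n • r.val e := by
  induction n with
  | zero => rw [r.zero, zero_smul]; rfl
  | succ n ih =>
    rw [succ_nsmul, ← ih, Region.val, ← r.append]
    congr 1
    funext i
    induction i using Fin.addCases <;> simp

/-- The degenerate cells force a region to vanish on the distinguished label. -/
theorem Region.val_point {C : HDA.{u}} (r : C.Region) : r.val C.labels.point = 0 := by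
  have key : ∀ n : ℕ, ∃ k : ℕ, r.S C.init = k + n * (r.val C.labels.point).1 ∧
      r.S C.init = k + n * (r.val C.labels.point).2 := by
    intro n
    let d : (⟨n⟩ : BoxS) ⟶ ⟨0⟩ := BoxS.Hom.mk (m := ⟨n⟩) (n := ⟨0⟩) Fin.elim0 fun i => i.elim0
    let y : C.Cell n := C.cells.map d.op C.init
    have hv : ∀ α, C.vertex α y = C.init := by
      intro α
      have h : BoxS.corner α n ≫ d = 𝟙 _ := by
        apply BoxS.Hom.ext; funext i; exact i.elim0
      change C.cells.map (BoxS.corner α n).op (C.cells.map d.op C.init) = C.init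
      rw [← CategoryTheory.comp_apply, ← Functor.map_comp, ← op_comp, h]
      simp
    have hl : C.lab y = fun _ => C.labels.point := by
      refine (NatTrans.naturality_apply C.label d.op C.init).trans ?_
      funext j
      exact pushLabel_of_ne C.labels.point d (C.lab C.init) (j := j) (fun i => Fin.elim0 i)
    obtain ⟨k, h1, h2⟩ := r.cond n y
    rw [hv, hl, r.R_const] at h1 h2
    exact ⟨k, by simpa using h1, by simpa using h2⟩
  obtain ⟨k, h1, h2⟩ := key (r.S C.init + 1)
  ext
  · by_contra h
    have h : 1 ≤ (r.val C.labels.point).1 := Nat.one_le_iff_ne_zero.2 h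
    nlinarith
  · by_contra h
    have h : 1 ≤ (r.val C.labels.point).2 := Nat.one_le_iff_ne_zero.2 h
    nlinarith

/-- The inverse image of a region along a morphism of HDA. -/
def Region.comap {C D : HDA.{u}} (f : C ⟶ D) (r : D.Region) : C.Region where
  R n l := r.R n ((Hom.lam f).toFun ∘ l)
  append m n e e' := by
    rw [← r.append]
    congr 1
    funext i
    induction i using Fin.addCases <;> simp
  zero e := r.zero _
  S x := r.S ((Hom.map f).app (op ⟨0⟩) x)
  cond n y := by
    obtain ⟨k, h⟩ := r.cond n ((Hom.map f).app (op ⟨n⟩) y)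
    rw [Hom.lab_map, Hom.vertex_map, Hom.vertex_map] at h
    exact ⟨k, h⟩

/-- The Petri net of an HDA: its places are the regions, and its events are the labels different
from the distinguished one. -/
def toPNet (C : HDA.{u}) : PNet.{u} where
  P := C.Region
  E := {e : C.labels.X // e ≠ C.labels.point}
  init r := r.S C.init
  pre e r := (r.val e.1).1
  post e r := (r.val e.1).2

open Classical in
/-- An element of a pointed set as an element, or no element, of the complement of the
distinguished point. -/
noncomputable def toOption (L : Pointed.{u}) (e : L.X) : Option {e : L.X // e ≠ L.point} :=
  if h : e ≠ L.point then some ⟨e, h⟩ else none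

theorem toOption_point (L : Pointed.{u}) : toOption L L.point = none := by
  simp [toOption]

theorem toOption_of_ne (L : Pointed.{u}) (e : L.X) (h : e ≠ L.point) :
    toOption L e = some ⟨e, h⟩ := by
  simp [toOption, h]

theorem preO_toOption (C : HDA.{u}) (e : C.labels.X) (r : C.Region) :
    C.toPNet.preO (toOption C.labels e) r = (r.val e).1 := by
  by_cases h : e = C.labels.point
  · subst h; rw [toOption_point, r.val_point]; rfl
  · rw [toOption_of_ne _ _ h]; rfl

theorem postO_toOption (C : HDA.{u}) (e : C.labels.X) (r : C.Region) :
    C.toPNet.postO (toOption C.labels e) r = (r.val e).2 := by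
  by_cases h : e = C.labels.point
  · subst h; rw [toOption_point, r.val_point]; rfl
  · rw [toOption_of_ne _ _ h]; rfl

/-- The morphism of nets induced by a morphism of HDA. -/
noncomputable def toPNetMap {C D : HDA.{u}} (f : C ⟶ D) : C.toPNet ⟶ D.toPNet :=
  PNet.Hom.mk (N := C.toPNet) (N' := D.toPNet)
    (Region.comap f)
    (fun e => toOption D.labels ((Hom.lam f).toFun e.1))
    (by
      funext r
      exact congrArg r.S (Hom.init f).symm)
    (fun e => funext fun r => preO_toOption D _ r)
    (fun e => funext fun r => postO_toOption D _ r)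

end HDA

/-- The functor `pn : HDA ⥤ PNet`. -/
noncomputable def pn : HDA.{u} ⥤ PNet.{u} where
  obj C := C.toPNet
  map f := HDA.toPNetMap f
  map_id C := by
    apply PNet.Hom.ext
    · rfl
    · funext e
      exact HDA.toOption_of_ne _ _ e.2
  map_comp {C D E} f g := by
    apply PNet.Hom.ext
    · rfl
    · funext e
      change HDA.toOption E.labels ((HDA.Hom.lam g).toFun ((HDA.Hom.lam f).toFun e.1)) =
        (HDA.toOption D.labels ((HDA.Hom.lam f).toFun e.1)).bind
          fun e' => HDA.toOption E.labels ((HDA.Hom.lam g).toFun e'.1)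
      by_cases h : (HDA.Hom.lam f).toFun e.1 = D.labels.point
      · rw [h, HDA.toOption_point, (HDA.Hom.lam g).map_point, HDA.toOption_point]; rfl
      · rw [HDA.toOption_of_ne _ _ h]; rfl

/-! A morphism of nets `(φ, ψ) : pn C ⟶ N` chooses a region `(R_p, S_p)` of `C` for every place `p`
of `N`, and so it assigns to each 0-cell `x` of `C` the marking `p ↦ S_p x`. Its transpose sends a cell
`y` with 0-source `x` to the marking of `x` together with the image under `ψ` of the label of `y`.
The region condition for `y` says that this generalized event is enabled. That the transpose commutes
with a cubical operator `f` is the region condition for the face of `y` in which exactly the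
coordinates that `f` makes constant equal to `+` are free: this face goes from the 0-source of `y` to
that of `f^* y` (`HDA.Region.exists_vertex_eq`).

Conversely, a morphism `(κ, λ)` from `C` to the HDA of `N` defines, for each place `p`, the region
whose state function is the number of tokens of `κ x` in `p`, and whose values on labels are the
pre- and postconditions of their images under `λ` at `p`. The two constructions are mutually inverse
since a region is determined by its states and its values on single labels different from `*`
(`HDA.Region.ext_val`), and a morphism to the HDA of a net is determined by its labels and the
markings at 0-cells (`HDA.hom_hdaOn_ext`).

All this works for any set of states of `N` in which the markings `p ↦ S_p x` lie
(`HDA.homEquivOn`). For the set of all markings there is nothing to check; for the reachable ones,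
a directed path from the initial state to `x` in `C` yields a sequence of transitions of `N`
(`HDA.reachable_markingAt`). Finally `hda N` is reachable because a generalized event can be fired one
event at a time. -/

/-! ### Regions -/

namespace HDA

theorem Region.R_eq_sum {C : HDA.{u}} (r : C.Region) {n : ℕ} (l : Fin n → C.labels.X) :
    r.R n l = ∑ i, r.val (l i) := by
  induction n with
  | zero => simp only [r.zero, Finset.univ_eq_empty, Finset.sum_empty]; rfl
  | succ n ih =>
    have h : l = Fin.append (fun i : Fin n => l (i.castAdd 1)) (fun _ : Fin 1 => l (Fin.last n)) := by
      funext i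
      induction i using Fin.addCases with
      | left i => simp
      | right i => rw [Fin.append_right, Subsingleton.elim i 0]; rfl
    rw [Fin.sum_univ_castSucc]
    conv_lhs => rw [h]
    rw [r.append, ih]
    rfl

/-- A region is determined by its states and by its values on the labels different from the
distinguished one, on which it vanishes. -/
theorem Region.ext_val {C : HDA.{u}} {r s : C.Region}
    (h : ∀ e, e ≠ C.labels.point → r.val e = s.val e) (hS : r.S = s.S) : r = s := by
  refine Region.ext ?_ hS
  funext n l
  rw [r.R_eq_sum, s.R_eq_sum]
  refine Finset.sum_congr rfl fun i _ => ?_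
  by_cases hi : l i = C.labels.point
  · rw [hi, r.val_point, s.val_point]
  · exact h _ hi

end HDA

/-! ### The face of the coordinates that are constant equal to `+` -/

/-- The endomorphism of the `n`-cube which keeps the coordinates that `f` makes constant equal to `+`,
and makes the other ones constant equal to `-`. Taking it from the `n`-cube, rather than from the cube
of the kept coordinates, avoids renumbering them; the unused inputs only contribute labels `*`, on
which regions vanish. -/
def BoxS.plusFace {m n : BoxS} (f : m ⟶ n) : n ⟶ n :=
  BoxS.Hom.mk (m := n) (n := n)
    (fun i => if BoxS.Hom.toFun f i = Sum.inl true then Sum.inr i else Sum.inl false) (by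
      intro i i' j h h'
      split_ifs at h h'
      exact Sum.inr_injective (h.trans h'.symm))

theorem BoxS.corner_false_plusFace {m n : BoxS} (f : m ⟶ n) :
    BoxS.corner false n.dim ≫ BoxS.plusFace f = BoxS.corner false n.dim := by
  apply BoxS.Hom.ext; funext i
  rw [BoxS.comp_toFun]
  by_cases h : BoxS.Hom.toFun f i = Sum.inl true <;> simp [BoxS.plusFace, BoxS.corner, h]

theorem BoxS.corner_true_plusFace {m n : BoxS} (f : m ⟶ n) :
    BoxS.corner true n.dim ≫ BoxS.plusFace f = BoxS.corner false m.dim ≫ f := by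
  apply BoxS.Hom.ext; funext i
  rw [BoxS.comp_toFun, BoxS.comp_toFun]
  cases h : BoxS.Hom.toFun f i with
  | inl b => cases b <;> simp [BoxS.plusFace, h, BoxS.corner]
  | inr j => simp [BoxS.plusFace, h, BoxS.corner]

theorem pushLabel_plusFace {X : Type u} (pt : X) {m n : BoxS} (f : m ⟶ n) (l : Fin n.dim → X)
    (i : Fin n.dim) :
    pushLabel pt (BoxS.plusFace f) l i =
      if BoxS.Hom.toFun f i = Sum.inl true then l i else pt := by
  split_ifs with h
  · exact pushLabel_of_eq pt _ l (by simp [BoxS.plusFace, h])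
  · refine pushLabel_of_ne pt _ l fun i' h' => ?_
    simp only [BoxS.plusFace] at h'
    split_ifs at h' with h''
    rw [Sum.inr_injective h'] at h''
    exact h h''

namespace HDA

theorem lab_map_op (C : HDA.{u}) {m n : BoxS} (f : m ⟶ n) (y : C.Cell n.dim) :
    C.lab (n := m.dim) (C.cells.map f.op y) = pushLabel C.labels.point f (C.lab y) :=
  NatTrans.naturality_apply C.label f.op y

theorem vertex_map_op (C : HDA.{u}) (α : Bool) {m n : BoxS} (f : m ⟶ n) (y : C.Cell n.dim) :
    C.vertex α (n := m.dim) (C.cells.map f.op y) =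
      C.cells.map (BoxS.corner α m.dim ≫ f).op y := by
  change C.cells.map (BoxS.corner α m.dim).op (C.cells.map f.op y) = _
  rw [← CategoryTheory.comp_apply, ← Functor.map_comp, ← op_comp]

theorem vertex_zero (C : HDA.{u}) (α : Bool) (x : C.Cell 0) : C.vertex α x = x := by
  change C.cells.map (BoxS.corner α 0).op x = x
  rw [BoxS.corner_zero]
  simp

/-- The region condition for the face of `y` that joins the 0-source of `y` to the 0-source
of `f^* y`: the state changes by the values of the labels at which `f` is constant equal to `+`. -/
theorem Region.exists_vertex_eq {C : HDA.{u}} (r : C.Region) {m n : BoxS} (f : m ⟶ n)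
    (y : C.Cell n.dim) :
    ∃ k : ℕ,
      r.S (C.vertex false y) =
        k + ∑ i, (if BoxS.Hom.toFun f i = Sum.inl true then 1 else 0) * (r.val (C.lab y i)).1 ∧
      r.S (C.vertex false (n := m.dim) (C.cells.map f.op y)) =
        k + ∑ i, (if BoxS.Hom.toFun f i = Sum.inl true then 1 else 0) * (r.val (C.lab y i)).2 := by
  obtain ⟨k, h1, h2⟩ := r.cond n.dim (C.cells.map (BoxS.plusFace f).op y)
  rw [vertex_map_op, BoxS.corner_false_plusFace] at h1
  rw [vertex_map_op, BoxS.corner_true_plusFace] at h2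
  rw [lab_map_op, r.R_eq_sum] at h1 h2
  have key : ∀ i, r.val (pushLabel C.labels.point (BoxS.plusFace f) (C.lab y) i) =
      (if BoxS.Hom.toFun f i = Sum.inl true then 1 else 0) • r.val (C.lab y i) := by
    intro i
    rw [pushLabel_plusFace]
    split_ifs
    · rw [one_smul]
    · rw [zero_smul, r.val_point]
  refine ⟨k, h1.trans ?_, ?_⟩
  · simp only [Prod.fst_sum, key, Prod.smul_fst, smul_eq_mul]
  · rw [vertex_map_op, h2]
    simp only [Prod.snd_sum, key, Prod.smul_snd, smul_eq_mul]

/-! ### The transpose of a morphism of nets -/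

/-- The extension of the event part of a morphism `C.toPNet ⟶ N` to all labels of `C`. -/
noncomputable def eventOf {C : HDA.{u}} {N : PNet.{u}} (g : C.toPNet ⟶ N) (e : C.labels.X) :
    Option N.E :=
  (toOption C.labels e).bind (PNet.Hom.onEvent g)

/-- The marking of `N` which a morphism `C.toPNet ⟶ N` assigns to a 0-cell of `C`. -/
def markingAt {C : HDA.{u}} {N : PNet.{u}} (g : C.toPNet ⟶ N) (x : C.Cell 0) : N.Marking :=
  fun p => (PNet.Hom.onPlace g p).S x

theorem preO_eventOf {C : HDA.{u}} {N : PNet.{u}} (g : C.toPNet ⟶ N) (e : C.labels.X) (p : N.P) :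
    N.preO (eventOf g e) p = (Region.val (PNet.Hom.onPlace g p) e).1 :=
  (congrFun (PNet.Hom.preO_bind g _) p).trans (preO_toOption C e _)

theorem postO_eventOf {C : HDA.{u}} {N : PNet.{u}} (g : C.toPNet ⟶ N) (e : C.labels.X) (p : N.P) :
    N.postO (eventOf g e) p = (Region.val (PNet.Hom.onPlace g p) e).2 :=
  (congrFun (PNet.Hom.postO_bind g _) p).trans (postO_toOption C e _)

theorem markingAt_init {C : HDA.{u}} {N : PNet.{u}} (g : C.toPNet ⟶ N) :
    markingAt g C.init = N.init :=
  (PNet.Hom.init g).symm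

/-- The region condition for a cell says that its image is a transition. -/
theorem step_markingAt {C : HDA.{u}} {N : PNet.{u}} (g : C.toPNet ⟶ N) {n : ℕ} (y : C.Cell n) :
    N.Step (markingAt g (C.vertex false y)) (fun i => eventOf g (C.lab y i))
      (markingAt g (C.vertex true y)) := by
  choose K h1 h2 using fun p => Region.cond (PNet.Hom.onPlace g p) n y
  refine ⟨K, funext fun p => ?_, funext fun p => ?_⟩
  · rw [Pi.add_apply, PNet.preL_apply]
    simp only [preO_eventOf]
    rw [← Prod.fst_sum, ← (PNet.Hom.onPlace g p).R_eq_sum]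
    exact h1 p
  · rw [Pi.add_apply, PNet.postL_apply]
    simp only [postO_eventOf]
    rw [← Prod.snd_sum, ← (PNet.Hom.onPlace g p).R_eq_sum]
    exact h2 p

theorem markingAt_map_op {C : HDA.{u}} {N : PNet.{u}} (g : C.toPNet ⟶ N) {m n : BoxS} (f : m ⟶ n)
    (y : C.Cell n.dim) :
    markingAt g (C.vertex false (n := m.dim) (C.cells.map f.op y)) =
      N.fire (markingAt g (C.vertex false y))
        (N.plusPart f fun i => eventOf g (C.lab y i)) := by
  funext p
  obtain ⟨k, h1, h2⟩ := Region.exists_vertex_eq (PNet.Hom.onPlace g p) f y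
  have e1 := N.sum_plusPart (fun e => N.preO e p) rfl f fun i => eventOf g (C.lab y i)
  have e2 := N.sum_plusPart (fun e => N.postO e p) rfl f fun i => eventOf g (C.lab y i)
  simp only [preO_eventOf] at e1
  simp only [postO_eventOf] at e2
  simp only [PNet.fire, Pi.add_apply, Pi.sub_apply, PNet.preL_apply, PNet.postL_apply, e1, e2]
  simp only [markingAt, h1, h2]
  rw [Nat.add_sub_cancel]

theorem reachable_markingAt {C : HDA.{u}} (hC : IsReachable C) {N : PNet.{u}} (g : C.toPNet ⟶ N)
    (x : C.Cell 0) : N.Reachable (markingAt g x) := by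
  induction hC x with
  | refl => rw [markingAt_init]; exact Relation.ReflTransGen.refl
  | tail _ h ih =>
    obtain ⟨y, rfl, rfl⟩ := h
    exact ih.tail ⟨1, _, step_markingAt g y⟩

/-- The morphism of HDA corresponding to a morphism of nets `C.toPNet ⟶ N`: it sends a cell to the
marking of its 0-source together with the image of its label. -/
noncomputable def transpose {C : HDA.{u}} {N : PNet.{u}} (S : N.StateSet) (g : C.toPNet ⟶ N)
    (h : ∀ x, markingAt g x ∈ S.carrier) : C ⟶ N.hdaOn S :=
  HDA.Hom.mk (C := C) (D := N.hdaOn S)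
    { app := fun n => TypeCat.ofHom fun y : C.Cell n.unop.dim =>
        (⟨markingAt g (C.vertex false y), fun i => eventOf g (C.lab y i), h _,
          ⟨_, step_markingAt g y⟩⟩ : N.EvCell S n.unop.dim)
      naturality := fun n m f => by
        refine ConcreteCategory.hom_ext _ _ fun y => ?_
        refine PNet.EvCell.ext (markingAt_map_op g f.unop y) ?_
        refine Eq.trans ?_ (pushLabel_map C.labels.point none (eventOf g)
          (by rw [eventOf, toOption_point]; rfl) f.unop (C.lab y)).symm
        exact congrArg (eventOf g ∘ ·) (C.lab_map_op f.unop y) }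
    ⟨eventOf g, by rw [eventOf, toOption_point]; rfl⟩
    rfl
    (PNet.EvCell.ext ((congrArg (markingAt g) (C.vertex_zero false C.init)).trans (markingAt_init g))
      (funext fun i => i.elim0))

end HDA

/-! ### The transpose of a morphism of HDA -/

namespace PNet

theorem marking_vertex_false (N : PNet.{u}) (S : N.StateSet) {n : ℕ} (c : (N.hdaOn S).Cell n) :
    EvCell.marking ((N.hdaOn S).vertex false c) = EvCell.marking c := by
  change N.fire (EvCell.marking c) (N.plusPart (BoxS.corner false n) (EvCell.event c)) = _
  funext p
  simp [fire, preL_apply, postL_apply, plusPart, BoxS.corner, preO, postO]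

theorem marking_vertex_true (N : PNet.{u}) (S : N.StateSet) {n : ℕ} (c : (N.hdaOn S).Cell n) :
    EvCell.marking ((N.hdaOn S).vertex true c) = N.fire (EvCell.marking c) (EvCell.event c) := by
  change N.fire (EvCell.marking c) (N.plusPart (BoxS.corner true n) (EvCell.event c)) = _
  congr 1

theorem preL_append (N : PNet.{u}) {m n : ℕ} (e : Fin m → Option N.E) (f : Fin n → Option N.E) :
    N.preL (Fin.append e f) = N.preL e + N.preL f := by
  simp [preL, Fin.sum_univ_add]

theorem postL_append (N : PNet.{u}) {m n : ℕ} (e : Fin m → Option N.E) (f : Fin n → Option N.E) :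
    N.postL (Fin.append e f) = N.postL e + N.postL f := by
  simp [postL, Fin.sum_univ_add]

/-- Each place `p` of a net gives a region of its HDA, whose states are the numbers of tokens
in `p`. -/
def placeRegion (N : PNet.{u}) (S : N.StateSet) (p : N.P) : (N.hdaOn S).Region where
  R n (l : Fin n → Option N.E) := (N.preL l p, N.postL l p)
  append m n e f :=
    Prod.ext (congrFun (N.preL_append e f) p) (congrFun (N.postL_append e f) p)
  zero _ := Prod.ext (N.preL_apply _ p) (N.postL_apply _ p)
  S c := EvCell.marking c p
  cond n c := by
    obtain ⟨K, h1, h2⟩ := ((N.step_iff _ _ _).2 ⟨EvCell.enabled c, rfl⟩ :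
      N.Step (EvCell.marking c) (EvCell.event c) _)
    refine ⟨K p, ?_, ?_⟩
    · exact congrFun ((N.marking_vertex_false S c).trans h1) p
    · exact congrFun ((N.marking_vertex_true S c).trans h2) p

theorem placeRegion_val (N : PNet.{u}) (S : N.StateSet) (p : N.P) (e : Option N.E) :
    HDA.Region.val (N.placeRegion S p) e = (N.preO e p, N.postO e p) := by
  change (N.preL (fun _ : Fin 1 => e) p, N.postL (fun _ : Fin 1 => e) p) = _
  simp [preL_apply, postL_apply]

end PNet

namespace HDA

/-- The morphism of nets corresponding to a morphism from `C` to the HDA of a net. -/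
noncomputable def untranspose {C : HDA.{u}} {N : PNet.{u}} {S : N.StateSet} (f : C ⟶ N.hdaOn S) :
    C.toPNet ⟶ N :=
  PNet.Hom.mk (N := C.toPNet) (N' := N)
    (fun p => (N.placeRegion S p).comap f)
    (fun e => (Hom.lam f).toFun e.1)
    (funext fun p => congrArg (fun c => PNet.EvCell.marking c p) (Hom.init f).symm)
    (fun _ => funext fun p => (congrArg Prod.fst (N.placeRegion_val S p _)).symm)
    (fun _ => funext fun p => (congrArg Prod.snd (N.placeRegion_val S p _)).symm)

/-- A morphism to the HDA of a net is determined by its labels and its markings at 0-cells, because the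
marking of a cell is that of its 0-source. -/
theorem hom_hdaOn_ext {C : HDA.{u}} {N : PNet.{u}} {S : N.StateSet} {f g : C ⟶ N.hdaOn S}
    (hlam : (Hom.lam f).toFun = (Hom.lam g).toFun)
    (hmark : ∀ x : C.Cell 0, PNet.EvCell.marking ((Hom.map f).app (op ⟨0⟩) x) =
      PNet.EvCell.marking ((Hom.map g).app (op ⟨0⟩) x)) : f = g := by
  apply Hom.ext
  · refine NatTrans.ext (funext fun n => ConcreteCategory.hom_ext _ _ fun y => ?_)
    refine PNet.EvCell.ext ?_ ?_
    · have hf := Hom.vertex_map f false (n := n.unop.dim) y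
      have hg := Hom.vertex_map g false (n := n.unop.dim) y
      have h := hmark (C.vertex false (n := n.unop.dim) y)
      rw [← hf, ← hg, N.marking_vertex_false S, N.marking_vertex_false S] at h
      exact h
    · have hf := Hom.lab_map f (n := n.unop.dim) y
      have hg := Hom.lab_map g (n := n.unop.dim) y
      rw [hlam] at hf
      exact hf.trans hg.symm
  · exact Pointed.Hom.ext hlam

theorem markingAt_untranspose {C : HDA.{u}} {N : PNet.{u}} {S : N.StateSet} (f : C ⟶ N.hdaOn S)
    (x : C.Cell 0) :
    markingAt (untranspose f) x = PNet.EvCell.marking ((Hom.map f).app (op ⟨0⟩) x) :=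
  rfl

theorem eventOf_untranspose {C : HDA.{u}} {N : PNet.{u}} {S : N.StateSet} (f : C ⟶ N.hdaOn S) :
    eventOf (untranspose f) = (Hom.lam f).toFun := by
  funext e
  by_cases h : e = C.labels.point
  · rw [h, eventOf, toOption_point]
    exact (Hom.lam f).map_point.symm
  · rw [eventOf, toOption_of_ne _ _ h]
    rfl

theorem transpose_untranspose {C : HDA.{u}} {N : PNet.{u}} {S : N.StateSet} (f : C ⟶ N.hdaOn S)
    (h : ∀ x, markingAt (untranspose f) x ∈ S.carrier) : transpose S (untranspose f) h = f := by
  refine hom_hdaOn_ext (eventOf_untranspose f) fun x => ?_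
  refine Eq.trans ?_ (markingAt_untranspose f x)
  exact congrArg (markingAt (untranspose f)) (C.vertex_zero false x)

theorem untranspose_transpose {C : HDA.{u}} {N : PNet.{u}} {S : N.StateSet} (g : C.toPNet ⟶ N)
    (h : ∀ x, markingAt g x ∈ S.carrier) : untranspose (transpose S g h) = g := by
  apply PNet.Hom.ext
  · funext p
    refine Region.ext_val (fun e _ => ?_) (funext fun x => ?_)
    · refine (N.placeRegion_val S p (eventOf g e)).trans ?_
      rw [preO_eventOf, postO_eventOf]
    · exact congrArg (fun x => markingAt g x p) (C.vertex_zero false x)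
  · funext e
    change eventOf g e.1 = _
    rw [eventOf, toOption_of_ne _ _ e.2]
    rfl

/-! ### The adjunctions -/

/-- The bijection between morphisms from the net of `C` to `N` and morphisms from `C` to the HDA of `N`
with a set of states in which all markings assigned to 0-cells lie. -/
noncomputable def homEquivOn (C : HDA.{u}) (N : PNet.{u}) (S : N.StateSet)
    (h : ∀ (g : C.toPNet ⟶ N) (x), markingAt g x ∈ S.carrier) :
    (C.toPNet ⟶ N) ≃ (C ⟶ N.hdaOn S) where
  toFun g := transpose S g (h g)
  invFun f := untranspose f
  left_inv g := untranspose_transpose g (h g)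
  right_inv f := transpose_untranspose f _

theorem untranspose_comp {C D : HDA.{u}} {N : PNet.{u}} {S : N.StateSet} (f : C ⟶ D)
    (g : D ⟶ N.hdaOn S) : untranspose (f ≫ g) = toPNetMap f ≫ untranspose g := by
  apply PNet.Hom.ext
  · rfl
  · funext e
    exact (congrFun (eventOf_untranspose g) ((Hom.lam f).toFun e.1)).symm

theorem transpose_comp {C : HDA.{u}} {N N' : PNet.{u}} (S : N.StateSet) (S' : N'.StateSet)
    (g : C.toPNet ⟶ N) (t : N ⟶ N') (h : ∀ x, markingAt g x ∈ S.carrier)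
    (h' : ∀ x, markingAt (g ≫ t) x ∈ S'.carrier)
    (ht : ∀ M ∈ S.carrier, M ∘ PNet.Hom.onPlace t ∈ S'.carrier) :
    transpose S' (g ≫ t) h' = transpose S g h ≫ PNet.hdaOnMap t S S' ht :=
  hom_hdaOn_ext (funext fun _ => (Option.bind_assoc _ _ _).symm) fun _ => rfl

/-- Firing a generalized event one entry at a time. -/
theorem reflTransGen_of_step {N : PNet.{u}} {S : N.StateSet} {n : ℕ} {l : Fin n → Option N.E}
    {c c' : (N.hdaOn S).Cell 0}
    (h : N.Step (PNet.EvCell.marking c) l (PNet.EvCell.marking c')) :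
    Relation.ReflTransGen (N.hdaOn S).Edge c c' := by
  induction n generalizing c with
  | zero =>
    obtain ⟨K, h1, h2⟩ := h
    have : c = c' := PNet.EvCell.ext
      (h1.trans (Eq.trans (by simp [PNet.preL, PNet.postL]) h2.symm)) (funext fun i => i.elim0)
    rw [this]
  | succ n ih =>
    obtain ⟨K, h1, h2⟩ := h
    have hpre : N.preL l = N.preL (fun _ : Fin 1 => l 0) + N.preL (fun i : Fin n => l i.succ) := by
      simp [PNet.preL, Fin.sum_univ_succ]
    have hpost :
        N.postL l = N.postL (fun _ : Fin 1 => l 0) + N.postL (fun i : Fin n => l i.succ) := by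
      simp [PNet.postL, Fin.sum_univ_succ]
    -- the part of the marking not consumed by the first entry contains the precondition of the rest
    have hstep : N.Step (PNet.EvCell.marking c) (fun _ : Fin 1 => l 0)
        (K + N.postL (fun _ : Fin 1 => l 0) + N.preL (fun i : Fin n => l i.succ)) :=
      ⟨K + N.preL (fun i : Fin n => l i.succ), by rw [h1, hpre]; abel, by abel⟩
    let y : (N.hdaOn S).Cell 1 := (⟨PNet.EvCell.marking c, fun _ => l 0, PNet.EvCell.mem c,
      ⟨_, hstep⟩⟩ : N.EvCell S 1)
    have hsrc : (N.hdaOn S).vertex false y = c :=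
      PNet.EvCell.ext (N.marking_vertex_false S y) (funext fun i => i.elim0)
    have htgt := (N.marking_vertex_true S y).trans ((N.step_iff _ _ _).1 hstep).2.symm
    refine Relation.ReflTransGen.head ⟨y, hsrc, rfl⟩ (ih (l := fun i => l i.succ) ?_)
    exact ⟨K + N.postL (fun _ : Fin 1 => l 0), htgt, by rw [h2, hpost, add_assoc]⟩

theorem isReachable_hda (N : PNet.{u}) : IsReachable (hda.obj N) := by
  have key : ∀ M, N.Reachable M → ∀ c : (N.hdaOn N.reachableMarkings).Cell 0,
      PNet.EvCell.marking c = M →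
      Relation.ReflTransGen (N.hdaOn N.reachableMarkings).Edge
        (N.hdaOn N.reachableMarkings).init c := by
    intro M hM
    induction hM with
    | refl =>
      intro c hc
      have : c = (N.hdaOn N.reachableMarkings).init :=
        PNet.EvCell.ext hc (funext fun i => i.elim0)
      rw [this]
    | @tail M₁ M₂ hM₁ h ih =>
      intro c hc
      obtain ⟨n, l, h⟩ := h
      let c₁ : (N.hdaOn N.reachableMarkings).Cell 0 :=
        (⟨M₁, Fin.elim0, hM₁, (N.enabled_iff _ _).2 (by simp [PNet.preL])⟩ :
          N.EvCell N.reachableMarkings 0)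
      exact (ih c₁ rfl).trans (reflTransGen_of_step (c := c₁) (hc ▸ h))
  exact fun c => key _ (PNet.EvCell.mem c) c rfl

end HDA

/-- The adjunction for all markings. -/
noncomputable def pnAdjHdaAll : pn.{u} ⊣ hdaAll :=
  Adjunction.mkOfHomEquiv
    { homEquiv := fun C N => C.homEquivOn N N.allMarkings fun _ _ => trivial
      homEquiv_naturality_left_symm := fun f g => HDA.untranspose_comp f g
      homEquiv_naturality_right := fun {_ N N'} g t =>
        HDA.transpose_comp N.allMarkings N'.allMarkings g t
          (fun _ => trivial) (fun _ => trivial) fun _ _ => trivial }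

/-- The adjunction for reachable markings. The 0-cells of a reachable HDA have reachable markings, so
that the bijection of morphism sets is available for `hda`. -/
noncomputable def pnAdjHda :
    (HDA.IsReachable.ι ⋙ pn.{u}) ⊣ HDA.IsReachable.lift hda HDA.isReachable_hda :=
  Adjunction.mkOfHomEquiv
    { homEquiv := fun C N =>
        (C.obj.homEquivOn N N.reachableMarkings (HDA.reachable_markingAt C.property)).trans
          (HDA.IsReachable.fullyFaithfulι.homEquiv (X := C)
            (Y := (HDA.IsReachable.lift hda HDA.isReachable_hda).obj N)).symm
      homEquiv_naturality_left_symm := fun f g => HDA.untranspose_comp f.hom g.hom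
      homEquiv_naturality_right := fun {C N N'} g t =>
        ObjectProperty.hom_ext _ (HDA.transpose_comp N.reachableMarkings N'.reachableMarkings g t
          (HDA.reachable_markingAt C.property g) (HDA.reachable_markingAt C.property (g ≫ t))
          fun _ => PNet.Hom.reachable_map t) }

theorem mainTheorem1 :
    (∃ h : ∀ N : PNet.{u}, HDA.IsReachable (hda.obj N),
      Nonempty ((HDA.IsReachable.ι ⋙ pn) ⊣ HDA.IsReachable.lift hda h)) ∧
    Nonempty (pn.{u} ⊣ hdaAll) :=
  ⟨⟨HDA.isReachable_hda, ⟨pnAdjHda⟩⟩, ⟨pnAdjHdaAll⟩⟩
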